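/- Let $\mathbb X$ be a Polish space with its Borel $\sigma$-algebra and let $\Phi=\sum_{j<N}\delta_{X_j}$ be a finite simple point process on $\mathbb X$ ($N$ is a random non-negative integer and the points $X_j$, $j<N$, are almost surely pairwise distinct). Let $\alpha>0$ and let the jumps $S_j$ be i.i.d. $\mathrm{Gamma}(\alpha,1)$ (shape $\alpha$, rate $1$), independent of $\Phi$. Put $\tilde\mu=\sum_{j<N}S_j\,\delta_{X_j}$ and $\tilde p=\tilde\mu/\tilde\mu(\mathbb X)$, with $\tilde p=0$ if $\tilde\mu(\mathbb X)=0$. Let $n\ge 1$ and let $\mathbf Y=(Y_1,\dots,Y_n)$ be i.i.d. from $\tilde p$ given $\tilde\mu$; on the event $\tilde\mu(\mathbb X)=0$ no observations are generated, and probabilities of events concerning $\mathbf Y$ are understood on the event $\tilde\mu(\mathbb X)>0$. Let $\tilde\pi$ be the partition of $\{1,\dots,n\}$ given by $i\sim j$ if and only if $Y_i=Y_j$, let $K_n$ be the number of its blocks, and let $\mathbf Y^*=(Y^*_1,\dots,Y^*_{K_n})$ be the vector of the distinct values, listed in any order of the blocks that depends only on $\tilde\pi$ (for example, the order of appearance).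 For $k\ge 1$ let $M_{\Phi^k}(B)=\mathsf E[\Phi^k(B)]$ be the $k$-th moment measure of $\Phi$, where $\Phi^k$ is the $k$-fold product measure on $\mathbb X^k$. Let $\{\mathbf P_\Phi^{\mathbf x}\}_{\mathbf x\in\mathbb X^k}$ be any family of $k$-th Palm distributions of $\Phi$, that is, a probability kernel with $\mathsf E[\mathbf 1_L(\Phi)\,\Phi^k(B)]=\int_B\mathbf P_\Phi^{\mathbf x}(L)\,M_{\Phi^k}(d\mathbf x)$ for all measurable $B\subseteq\mathbb X^k$ and all measurable sets $L$ of measures on $\mathbb X$. For $\mathbf y^*=(y_1^*,\dots,y_k^*)$ and $r\ge 0$ let $q_r=q_r(\mathbf y^*)$ be the probability that $\Phi_{\mathbf y^*}-\sum_{j=1}^k\delta_{y_j^*}$ has total mass $r$, where $\Phi_{\mathbf y^*}\sim\mathbf P_\Phi^{\mathbf y^*}$ (so $q_r$ is the probability that the reduced Palm version of $\Phi$ at $\mathbf y^*$ has $r$ points). Let $\mathcal C(n,k;s)$ be the generalized factorial coefficients, defined by $\mathcal C(0,0;s)=1$, $\mathcal C(n,0;s)=0$ for $n>0$, $\mathcal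 C(n,k;s)=0$ for $k>n$, and $\mathcal C(n,k;s)=s\,\mathcal C(n-1,k-1;s)+(ks-n+1)\,\mathcal C(n-1,k;s)$. Then, as measures on the set of $k$-tuples $\mathbf y^*\in\mathbb X^k$ with pairwise distinct entries, $$\mathsf P(K_n=k,\ \mathbf Y^*\in d\mathbf y^*)=(-1)^n\,\mathcal C(n,k;-\alpha)\left(\sum_{r\ge 0}q_r(\mathbf y^*)\,\frac{\Gamma((k+r)\alpha)}{\Gamma((k+r)\alpha+n)}\right)M_{\Phi^k}(d\mathbf y^*),$$ and the left-hand side gives no mass to $k$-tuples with two equal entries. -/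

import Mathlib

open MeasureTheory ProbabilityTheory Finset
open scoped ENNReal

namespace NRM

noncomputable section

/-- The (central) generalized factorial coefficients `C(n, k; s)`, given by
`C(0, 0; s) = 1`, `C(n, 0; s) = 0` for `n > 0`, `C(n, k; s) = 0` for `k > n`, and
`C(n, k; s) = s C(n - 1, k - 1; s) + (k s - n + 1) C(n - 1, k; s)`. -/
def genFactCoeff (s : ℝ) : ℕ → ℕ → ℝ
  | 0, 0 => 1
  | 0, _ + 1 => 0
  | _ + 1, 0 => 0
  | n + 1, k + 1 =>
      s * genFactCoeff s n k + (((k : ℝ) + 1) * s - n) * genFactCoeff s n (k + 1)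

theorem genFactCoeff_eq_zero (s : ℝ) : ∀ n k : ℕ, n < k → genFactCoeff s n k = 0
  | 0, 0, h => absurd h (lt_irrefl 0)
  | 0, _ + 1, _ => rfl
  | _ + 1, 0, h => absurd h (Nat.not_lt_zero _)
  | n + 1, k + 1, h => by
      rw [genFactCoeff, genFactCoeff_eq_zero s n k (by omega),
        genFactCoeff_eq_zero s n (k + 1) (by omega)]
      ring

/-- The defining property of the generalized factorial coefficients: they are the coefficients
of the expansion `(s t)_n = ∑ₖ C(n, k; s) (t)_k` in falling factorials. -/
theorem genFactCoeff_expansion (s t : ℝ) (n : ℕ) :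
    (descPochhammer ℝ n).eval (s * t) =
      ∑ k ∈ range (n + 1), genFactCoeff s n k * (descPochhammer ℝ k).eval t := by
  induction n with
  | zero => simp [genFactCoeff]
  | succ n ih =>
    have h0 : ((n : ℝ)) * genFactCoeff s n 0 = 0 := by
      cases n with
      | zero => simp
      | succ m => simp [genFactCoeff]
    rw [descPochhammer_succ_eval, ih, Finset.sum_mul]
    have key : ∀ k ∈ range (n + 1),
        genFactCoeff s n k * (descPochhammer ℝ k).eval t * (s * t - n) =
          s * genFactCoeff s n k * (descPochhammer ℝ (k + 1)).eval t
            + ((k : ℝ) * s - n) * genFactCoeff s n k * (descPochhammer ℝ k).eval t := by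
      intro k _
      rw [descPochhammer_succ_eval]
      ring
    rw [Finset.sum_congr rfl key, Finset.sum_add_distrib]
    have e2 : ∑ k ∈ range (n + 1),
          ((k : ℝ) * s - n) * genFactCoeff s n k * (descPochhammer ℝ k).eval t =
        ∑ k ∈ range (n + 1), (((k : ℝ) + 1) * s - n) * genFactCoeff s n (k + 1)
          * (descPochhammer ℝ (k + 1)).eval t := by
      rw [Finset.sum_range_succ']
      conv_rhs => rw [Finset.sum_range_succ]
      rw [genFactCoeff_eq_zero s n (n + 1) (Nat.lt_succ_self n)]
      have h0' : (((0 : ℕ) : ℝ) * s - n) * genFactCoeff s n 0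
          * (descPochhammer ℝ 0).eval t = 0 := by
        have : (((0 : ℕ) : ℝ) * s - n) * genFactCoeff s n 0 = 0 := by
          push_cast; linarith
        rw [this, zero_mul]
      rw [h0']
      push_cast
      ring
    rw [e2, ← Finset.sum_add_distrib, Finset.sum_range_succ' _ (n + 1)]
    simp only [genFactCoeff, zero_mul, add_zero]
    exact Finset.sum_congr rfl fun k _ => by ring

/-- A finite simple point process `Φ = ∑_{j < N} δ_{X_j}` on `X`, together with marks `S_j` that
are i.i.d. with law `H` and independent of `Φ`. `N` is `num`, `X_j` is `pt j`, `S_j` is `mark j`;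
the variables `pt j ω`, `mark j ω` with `num ω ≤ j` play no role in what follows. -/
structure MarkedPointProcess {Ω : Type*} [MeasurableSpace Ω] (P : Measure Ω)
    (X : Type*) [MeasurableSpace X] (H : Measure ℝ) where
  num : Ω → ℕ
  pt : ℕ → Ω → X
  mark : ℕ → Ω → ℝ
  measurable_num : Measurable num
  measurable_pt : ∀ j, Measurable (pt j)
  measurable_mark : ∀ j, Measurable (mark j)
  simple : ∀ᵐ ω ∂P, Set.InjOn (fun j => pt j ω) {j | j < num ω}
  law_mark : ∀ j, P.map (mark j) = H
  iIndepFun_mark : iIndepFun mark P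
  indepFun_mark : IndepFun (fun ω => (num ω, fun j => pt j ω)) (fun ω j => mark j ω) P

variable {Ω : Type*} [MeasurableSpace Ω] {P : Measure Ω} {X : Type*} [MeasurableSpace X]
  {H : Measure ℝ}

/-- The point process `Φ = ∑_j δ_{X_j}`, as a random measure. -/
def MarkedPointProcess.Phi (Ψ : MarkedPointProcess P X H) (ω : Ω) : Measure X :=
  ∑ j ∈ range (Ψ.num ω), Measure.dirac (Ψ.pt j ω)

/-- The random measure `μ̃ = ∑_j S_j δ_{X_j}`. -/
def MarkedPointProcess.mu (Ψ : MarkedPointProcess P X H) (ω : Ω) : Measure X :=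
  ∑ j ∈ range (Ψ.num ω), ENNReal.ofReal (Ψ.mark j ω) • Measure.dirac (Ψ.pt j ω)

/-- The normalized random measure `p̃ = μ̃ / μ̃(X)`; it is the zero measure if `μ̃(X) = 0`. -/
def MarkedPointProcess.pTilde (Ψ : MarkedPointProcess P X H) (ω : Ω) : Measure X :=
  (Ψ.mu ω Set.univ)⁻¹ • Ψ.mu ω

/-- `Y = (Y_1, …, Y_n)` is a sample from the model: given `μ̃`, the `Y_i` are i.i.d. from `p̃`.
On the event `μ̃(X) = 0` the model generates no observation, and nothing is asked of `Y` there. -/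
def IsSample (Ψ : MarkedPointProcess P X H) {n : ℕ} (Y : Ω → Fin n → X) : Prop :=
  Measurable Y ∧ ∀ A : Set (Fin n → X), MeasurableSet A →
    ∀ L : Set (Measure X), MeasurableSet L →
      P {ω | Ψ.mu ω Set.univ ≠ 0 ∧ Y ω ∈ A ∧ Ψ.mu ω ∈ L} =
        ∫⁻ ω in {ω | Ψ.mu ω ∈ L}, Measure.pi (fun _ : Fin n => Ψ.pTilde ω) A ∂P

/-- The `k`-th moment measure `M_{Φ^k}(B) = E[Φ^k(B)]`, where `Φ^k` is the `k`-fold product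
measure. -/
def MarkedPointProcess.momentMeasure (Ψ : MarkedPointProcess P X H) (k : ℕ) :
    Measure (Fin k → X) :=
  P.bind fun ω => Measure.pi fun _ : Fin k => Ψ.Phi ω

/-- `κ` is a family of `k`-th Palm distributions of `Φ`: a probability kernel that disintegrates
the `k`-th Campbell measure `C^k(B × L) = E[1_L(Φ) Φ^k(B)]` with respect to `M_{Φ^k}`. -/
def IsPalm (Ψ : MarkedPointProcess P X H) {k : ℕ} (κ : Kernel (Fin k → X) (Measure X)) : Prop :=
  IsMarkovKernel κ ∧ ∀ B : Set (Fin k → X), MeasurableSet B →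
    ∀ L : Set (Measure X), MeasurableSet L →
      ∫⁻ ω in {ω | Ψ.Phi ω ∈ L}, Measure.pi (fun _ : Fin k => Ψ.Phi ω) B ∂P =
        ∫⁻ x in B, κ x L ∂(Ψ.momentMeasure k)

/-- `q_r(x)`: the probability that the reduced Palm version `Φ_x - ∑_j δ_{x_j}` at `x` has
exactly `r` points, where `Φ_x` has law `κ x`. -/
def reducedCount {k : ℕ} (κ : Kernel (Fin k → X) (Measure X)) (x : Fin k → X) (r : ℕ) : ℝ≥0∞ :=
  κ x {ν | (ν - ∑ j, Measure.dirac (x j)) Set.univ = r}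

/-- The partition of the index set given by `i ∼ j ↔ y_i = y_j`. -/
def tiePartition {n : ℕ} (y : Fin n → X) : Setoid (Fin n) := Setoid.ker y

/-- `K_n`: the number of distinct values (blocks of the partition). -/
def numDistinct {n : ℕ} (y : Fin n → X) : ℕ := Nat.card (Quotient (tiePartition y))

/-- A rule that lists the blocks of every partition of the index set with `k` blocks,
naming each block by one of its elements; for instance, in the order of appearance. -/
def IsBlockListing {n k : ℕ} (ρ : Setoid (Fin n) → Fin k → Fin n) : Prop :=
  ∀ π : Setoid (Fin n), Nat.card (Quotient π) = k →
    Function.Bijective fun j : Fin k => Quotient.mk π (ρ π j)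

/-- The vector `Y*` of the distinct values, listed according to `ρ`. -/
def distinctValues {n k : ℕ} (ρ : Setoid (Fin n) → Fin k → Fin n) (y : Fin n → X) : Fin k → X :=
  fun j => y (ρ (tiePartition y) j)

end

end NRM

namespace NRM

noncomputable section

/-! Almost surely the points are distinct and the jumps positive. Given `N = m`, the sample is
therefore `X ∘ f` for a random assignment `f : Fin n → Fin m`, and `f` has probability `E ∏ᵢ S_{f i}
/ T^n`, where `T` is the sum of the `m` jumps. For gamma jumps this is `polyaWeight α f * Γ(mα) /
Γ(mα + n)` (`lintegral_prod_normalized_gamma`), independently of `N` and the points.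

The listed distinct values are `X ∘ g` for an injection `g : Fin k ↪ Fin m`. The weights of the
assignments `f` that produce a given `g` add up to `(-1)^n C(n, k; -α)`, whatever `g` and `m` are
(`sum_polyaWeight_listing`). Hence the left side is this constant times `∑ₘ Γ(mα) / Γ(mα + n) ∑_g
P(N = m, X ∘ g ∈ B)` (`IsSample.measure_distinctValues`).

Since `Φ` is simple, the sum over injections `g` is `Φ^k` restricted to tuples with distinct
entries. The Palm formula turns it into an integral of `κ x {ν | ν univ = m}` against the moment
measure (`IsPalm.setLIntegral_card_eq`). Under `κ x` the measure `ν` almost surely dominates `∑ⱼ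
δ_{xⱼ}`, so total mass `m = k + r` means reduced mass `r` (`IsPalm.ae_reducedCount_eq`). -/

/-! ### Gamma and beta integrals. -/

theorem lintegral_rpow_mul_exp_neg_mul_Ioi {a r : ℝ} (ha : 0 < a) (hr : 0 < r) :
    ∫⁻ x in Set.Ioi (0 : ℝ), ENNReal.ofReal (x ^ (a - 1) * Real.exp (-(r * x))) =
      ENNReal.ofReal (Real.Gamma a * r ^ (-a)) := by
  have hv := Real.integral_rpow_mul_exp_neg_mul_Ioi ha hr
  have hpos : 0 < (1 / r) ^ a * Real.Gamma a :=
    mul_pos (Real.rpow_pos_of_pos (by positivity) _) (Real.Gamma_pos_of_pos ha)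
  -- Integrability follows from the value: a non-integrable function would have integral 0.
  have hint : IntegrableOn (fun x : ℝ => x ^ (a - 1) * Real.exp (-(r * x))) (Set.Ioi 0) := by
    by_contra h
    rw [integral_undef h] at hv
    exact hpos.ne hv
  rw [← ofReal_integral_eq_lintegral_ofReal hint, hv]
  · rw [one_div, Real.inv_rpow hr.le, Real.rpow_neg hr.le, mul_comm]
  · filter_upwards [ae_restrict_mem measurableSet_Ioi] with x hx
    have hx0 : (0 : ℝ) < x := hx
    positivity

theorem lintegral_gammaMeasure_one {a : ℝ} {g : ℝ → ℝ≥0∞} (hg : Measurable g) :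
    ∫⁻ x, g x ∂(gammaMeasure a 1) =
      ∫⁻ x in Set.Ioi (0 : ℝ),
        ENNReal.ofReal ((Real.Gamma a)⁻¹ * (x ^ (a - 1) * Real.exp (-x))) * g x := by
  have hm : Measurable (gammaPDF a 1) := (measurable_gammaPDFReal a 1).ennreal_ofReal
  rw [gammaMeasure, lintegral_withDensity_eq_lintegral_mul _ hm hg]
  rw [← lintegral_indicator measurableSet_Ioi]
  refine lintegral_congr_ae ?_
  -- The origin is discarded because `gammaPDF` lives on the closed half-line and the right side on
  -- the open one.
  have h0 : ∀ᵐ x : ℝ, x ≠ 0 := by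
    simp [ae_iff]
  filter_upwards [h0] with x hx
  simp only [Pi.mul_apply]
  rcases lt_or_gt_of_ne hx with h | h
  · rw [gammaPDF_of_neg h, Set.indicator_of_notMem (by simpa using h.le), zero_mul]
  · rw [gammaPDF_of_nonneg h.le, Set.indicator_of_mem (by simpa using h)]
    congr 2
    simp
    ring

theorem gammaMeasure_Iic_zero {a : ℝ} : gammaMeasure a 1 (Set.Iic 0) = 0 := by
  rw [← lintegral_indicator_one measurableSet_Iic,
    lintegral_gammaMeasure_one (measurable_one.indicator measurableSet_Iic)]
  refine (setLIntegral_congr_fun measurableSet_Ioi fun x hx => ?_).trans lintegral_zero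
  simp [Set.indicator_of_notMem (show x ∉ Set.Iic (0 : ℝ) by simpa using hx)]

theorem ae_forall_pos_of_map_gammaMeasure {Ω : Type*} [MeasurableSpace Ω] {P : Measure Ω}
    {ι : Type*} [Countable ι] {a : ℝ} {S : ι → Ω → ℝ} (hS : ∀ j, Measurable (S j))
    (hlaw : ∀ j, P.map (S j) = gammaMeasure a 1) : ∀ᵐ ω ∂P, ∀ j, 0 < S j ω := by
  rw [ae_all_iff]
  intro j
  have h : P.map (S j) (Set.Iic 0) = 0 := by rw [hlaw, gammaMeasure_Iic_zero]
  rw [Measure.map_apply (hS j) measurableSet_Iic] at h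
  rw [ae_iff]
  convert h using 2
  ext ω
  simp

theorem lintegral_pow_mul_exp_gammaMeasure {a u : ℝ} (ha : 0 < a) (hu : 0 ≤ u) (l : ℕ) :
    ∫⁻ x, ENNReal.ofReal x ^ l * ENNReal.ofReal (Real.exp (-(u * x))) ∂(gammaMeasure a 1) =
      ENNReal.ofReal (Real.Gamma (a + l) / Real.Gamma a * (1 + u) ^ (-(a + l))) := by
  have hal : 0 < a + l := by positivity
  have hG := Real.Gamma_pos_of_pos ha
  rw [lintegral_gammaMeasure_one (by fun_prop)]
  have : ∀ x ∈ Set.Ioi (0 : ℝ),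
      ENNReal.ofReal ((Real.Gamma a)⁻¹ * (x ^ (a - 1) * Real.exp (-x))) *
        (ENNReal.ofReal x ^ l * ENNReal.ofReal (Real.exp (-(u * x)))) =
      ENNReal.ofReal (Real.Gamma a)⁻¹ *
        ENNReal.ofReal (x ^ (a + l - 1) * Real.exp (-((1 + u) * x))) := by
    intro x hx
    have hx0 : (0 : ℝ) < x := hx
    rw [← ENNReal.ofReal_pow hx0.le, ← ENNReal.ofReal_mul (by positivity),
      ← ENNReal.ofReal_mul (by positivity), ← ENNReal.ofReal_mul (by positivity)]
    congr 1
    rw [show a + l - 1 = (a - 1) + l by ring, Real.rpow_add_natCast hx0.ne',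
      show -((1 + u) * x) = -x + -(u * x) by ring, Real.exp_add]
    ring
  rw [setLIntegral_congr_fun measurableSet_Ioi this, lintegral_const_mul _ (by fun_prop),
    lintegral_rpow_mul_exp_neg_mul_Ioi hal (by positivity), ← ENNReal.ofReal_mul (by positivity)]
  congr 1
  field_simp

/-- A beta integral: the power of `1 + u` is written as a gamma integral in `x`, and Tonelli allows
integrating over `u` first. -/
theorem lintegral_rpow_mul_one_add_rpow {b c : ℝ} (hb : 0 < b) (hc : 0 < c) :
    ∫⁻ u in Set.Ioi (0 : ℝ), ENNReal.ofReal ((Real.Gamma c)⁻¹ * u ^ (c - 1)) *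
        ENNReal.ofReal ((1 + u) ^ (-(b + c))) =
      ENNReal.ofReal (Real.Gamma b / Real.Gamma (b + c)) := by
  have hbc : 0 < b + c := by positivity
  have hGc := Real.Gamma_pos_of_pos hc
  have hGbc := Real.Gamma_pos_of_pos hbc
  have e1 : ∀ u ∈ Set.Ioi (0 : ℝ), ENNReal.ofReal ((Real.Gamma c)⁻¹ * u ^ (c - 1)) *
        ENNReal.ofReal ((1 + u) ^ (-(b + c))) =
      ∫⁻ x in Set.Ioi (0 : ℝ), ENNReal.ofReal ((Real.Gamma c)⁻¹ * u ^ (c - 1)) *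
        (ENNReal.ofReal (Real.Gamma (b + c))⁻¹ *
        ENNReal.ofReal (x ^ (b + c - 1) * Real.exp (-((1 + u) * x)))) := by
    intro u hu
    have hu0 : (0 : ℝ) < u := hu
    rw [lintegral_const_mul _ (by fun_prop), lintegral_const_mul _ (by fun_prop),
      lintegral_rpow_mul_exp_neg_mul_Ioi hbc (by positivity),
      ← ENNReal.ofReal_mul (p := (Real.Gamma (b + c))⁻¹) (by positivity)]
    congr 2
    field_simp
  rw [setLIntegral_congr_fun measurableSet_Ioi e1, lintegral_lintegral_swap (by fun_prop)]
  have e2 : ∀ x ∈ Set.Ioi (0 : ℝ),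
      ∫⁻ u in Set.Ioi (0 : ℝ), ENNReal.ofReal ((Real.Gamma c)⁻¹ * u ^ (c - 1)) *
        (ENNReal.ofReal (Real.Gamma (b + c))⁻¹ *
        ENNReal.ofReal (x ^ (b + c - 1) * Real.exp (-((1 + u) * x)))) =
      ENNReal.ofReal (Real.Gamma (b + c))⁻¹ *
        ENNReal.ofReal (x ^ (b - 1) * Real.exp (-(1 * x))) := by
    intro x hx
    have hx0 : (0 : ℝ) < x := hx
    have e3 : ∀ u ∈ Set.Ioi (0 : ℝ), ENNReal.ofReal ((Real.Gamma c)⁻¹ * u ^ (c - 1)) *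
        (ENNReal.ofReal (Real.Gamma (b + c))⁻¹ *
        ENNReal.ofReal (x ^ (b + c - 1) * Real.exp (-((1 + u) * x)))) =
        ENNReal.ofReal ((Real.Gamma c)⁻¹ * (Real.Gamma (b + c))⁻¹ *
          (x ^ (b + c - 1) * Real.exp (-x))) *
        ENNReal.ofReal (u ^ (c - 1) * Real.exp (-(x * u))) := by
      intro u hu
      have hu0 : (0 : ℝ) < u := hu
      rw [← ENNReal.ofReal_mul (by positivity), ← ENNReal.ofReal_mul (by positivity),
        ← ENNReal.ofReal_mul (by positivity)]
      congr 1
      rw [show -((1 + u) * x) = -x + -(x * u) by ring, Real.exp_add]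
      ring
    rw [setLIntegral_congr_fun measurableSet_Ioi e3, lintegral_const_mul _ (by fun_prop),
      lintegral_rpow_mul_exp_neg_mul_Ioi hc hx0, ← ENNReal.ofReal_mul (by positivity),
      ← ENNReal.ofReal_mul (by positivity)]
    congr 1
    rw [show b + c - 1 = (b - 1) + c by ring, Real.rpow_add hx0, Real.rpow_neg hx0.le, one_mul]
    have := Real.rpow_pos_of_pos hx0 c
    field_simp
  rw [setLIntegral_congr_fun measurableSet_Ioi e2, lintegral_const_mul _ (by fun_prop),
    lintegral_rpow_mul_exp_neg_mul_Ioi hb one_pos, ← ENNReal.ofReal_mul (by positivity)]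
  congr 1
  simp
  field_simp

/-! ### Mixed moments of normalized gamma variables. -/

/-- The Pólya urn weight `∏ⱼ (α)^{(nⱼ)}` of an assignment, with `nⱼ` the size of the fibre
over `j` and `(α)^{(l)} = Γ(α + l) / Γ(α)`. -/
def polyaWeight {n : ℕ} {ι : Type*} [Fintype ι] [DecidableEq ι] (α : ℝ) (f : Fin n → ι) : ℝ :=
  ∏ j, Real.Gamma (α + #{i | f i = j}) / Real.Gamma α

theorem polyaWeight_pos {n : ℕ} {ι : Type*} [Fintype ι] [DecidableEq ι] {α : ℝ} (hα : 0 < α)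
    (f : Fin n → ι) : 0 < polyaWeight α f :=
  Finset.prod_pos fun _ _ => div_pos (Real.Gamma_pos_of_pos (by positivity))
    (Real.Gamma_pos_of_pos hα)

theorem prod_comp_eq_prod_pow_card {n : ℕ} {ι R : Type*} [Fintype ι] [DecidableEq ι]
    [CommMonoid R] (f : Fin n → ι) (s : ι → R) :
    ∏ i, s (f i) = ∏ j, s j ^ #{i | f i = j} := by
  rw [← Finset.prod_fiberwise univ f]
  refine Finset.prod_congr rfl fun j _ => ?_
  rw [Finset.prod_congr rfl (g := fun _ => s j), Finset.prod_const]
  intro i hi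
  rw [(Finset.mem_filter.1 hi).2]

theorem sum_card_fiber {n : ℕ} {ι : Type*} [Fintype ι] [DecidableEq ι] (f : Fin n → ι) :
    ∑ j, #{i | f i = j} = n := by
  rw [← Finset.card_eq_sum_card_fiberwise (fun _ _ => Finset.mem_coe.2 (mem_univ _))]
  simp

/-- The mixed moments of the normalization of i.i.d. gamma variables. -/
theorem lintegral_prod_normalized_gamma {Ω : Type*} [MeasurableSpace Ω] {P : Measure Ω}
    [IsProbabilityMeasure P] {ι : Type*} [Fintype ι] [DecidableEq ι] {α : ℝ} (hα : 0 < α)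
    {S : ι → Ω → ℝ} (hS : ∀ j, Measurable (S j)) (hlaw : ∀ j, P.map (S j) = gammaMeasure α 1)
    (hind : iIndepFun S P) {n : ℕ} (hn : 1 ≤ n) (f : Fin n → ι) :
    ∫⁻ ω, ∏ i, ((∑ j, ENNReal.ofReal (S j ω))⁻¹ * ENNReal.ofReal (S (f i) ω)) ∂P =
      ENNReal.ofReal (polyaWeight α f * (Real.Gamma (Fintype.card ι * α) /
        Real.Gamma (Fintype.card ι * α + n))) := by
  have hne : Nonempty ι := ⟨f ⟨0, hn⟩⟩
  have hn0 : (0 : ℝ) < n := by exact_mod_cast hn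
  have hGn := Real.Gamma_pos_of_pos hn0
  have hcard : (0 : ℝ) < Fintype.card ι := by exact_mod_cast Fintype.card_pos
  have hpos := ae_forall_pos_of_map_gammaMeasure hS hlaw
  -- Writing `T^(-n)` as `Γ(n)⁻¹ ∫ u^(n-1) exp(-uT) du` makes the integrand a product over the
  -- independent `S j`.
  have e1 : ∀ᵐ ω ∂P,
      ∏ i, ((∑ j, ENNReal.ofReal (S j ω))⁻¹ * ENNReal.ofReal (S (f i) ω)) =
        ∫⁻ u in Set.Ioi (0 : ℝ), ENNReal.ofReal ((Real.Gamma n)⁻¹ * u ^ ((n : ℝ) - 1)) *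
          ∏ j, (ENNReal.ofReal (S j ω) ^ #{i | f i = j} *
            ENNReal.ofReal (Real.exp (-(u * S j ω)))) := by
    filter_upwards [hpos] with ω hω
    set T : ℝ := ∑ j, S j ω with hT
    have hT0 : 0 < T := Finset.sum_pos (fun j _ => hω j) univ_nonempty
    have e3 : ∀ u ∈ Set.Ioi (0 : ℝ),
        ENNReal.ofReal ((Real.Gamma n)⁻¹ * u ^ ((n : ℝ) - 1)) *
          ∏ j, (ENNReal.ofReal (S j ω) ^ #{i | f i = j} *
            ENNReal.ofReal (Real.exp (-(u * S j ω)))) =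
        (ENNReal.ofReal (Real.Gamma n)⁻¹ * ∏ i, ENNReal.ofReal (S (f i) ω)) *
          ENNReal.ofReal (u ^ ((n : ℝ) - 1) * Real.exp (-(T * u))) := by
      intro u hu
      have hu0 : (0 : ℝ) < u := hu
      rw [Finset.prod_mul_distrib,
        ← prod_comp_eq_prod_pow_card f (fun j => ENNReal.ofReal (S j ω)),
        ← ENNReal.ofReal_prod_of_nonneg (s := univ)
          (f := fun j => Real.exp (-(u * S j ω))) (fun _ _ => (Real.exp_pos _).le),
        ← Real.exp_sum, Finset.sum_neg_distrib, ← Finset.mul_sum, ← hT,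
        ENNReal.ofReal_mul (by positivity), ENNReal.ofReal_mul (by positivity), mul_comm T u]
      ring
    rw [setLIntegral_congr_fun measurableSet_Ioi e3, lintegral_const_mul _ (by fun_prop),
      lintegral_rpow_mul_exp_neg_mul_Ioi hn0 hT0, Finset.prod_mul_distrib, Finset.prod_const,
      ← ENNReal.ofReal_sum_of_nonneg (fun j _ => (hω j).le), ← hT, Finset.card_univ,
      Fintype.card_fin, ← ENNReal.ofReal_inv_of_pos hT0, ← ENNReal.ofReal_pow (by positivity),
      mul_right_comm, ← ENNReal.ofReal_mul (by positivity)]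
    congr 2
    rw [Real.rpow_neg hT0.le, Real.rpow_natCast, inv_pow]
    field_simp
  rw [lintegral_congr_ae e1, lintegral_lintegral_swap (by fun_prop)]
  -- The factors contribute `(1 + u)^(-(α + nⱼ))`; since the fibre sizes add up to `n`, the exponent
  -- no longer depends on `f`.
  have e2 : ∀ u ∈ Set.Ioi (0 : ℝ),
      ∫⁻ ω, ENNReal.ofReal ((Real.Gamma n)⁻¹ * u ^ ((n : ℝ) - 1)) *
          ∏ j, (ENNReal.ofReal (S j ω) ^ #{i | f i = j} *
            ENNReal.ofReal (Real.exp (-(u * S j ω)))) ∂P =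
        ENNReal.ofReal (polyaWeight α f) *
          (ENNReal.ofReal ((Real.Gamma n)⁻¹ * u ^ ((n : ℝ) - 1)) *
          ENNReal.ofReal ((1 + u) ^ (-(Fintype.card ι * α + n)))) := by
    intro u hu
    have hu0 : (0 : ℝ) < u := hu
    have hφ : ∀ j : ι, Measurable fun x : ℝ => ENNReal.ofReal x ^ #{i | f i = j} *
        ENNReal.ofReal (Real.exp (-(u * x))) := fun j => by fun_prop
    rw [lintegral_const_mul _ (by fun_prop)]
    have hi := hind.comp _ hφ
    have h5 := lintegral_prod_eq_prod_lintegral_of_indepFun univ _ hi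
      (fun j => (hφ j).comp (hS j))
    simp only [Function.comp_apply] at h5
    rw [h5]
    have h6 : ∀ j ∈ (univ : Finset ι), ∫⁻ ω, ENNReal.ofReal (S j ω) ^ #{i | f i = j} *
            ENNReal.ofReal (Real.exp (-(u * S j ω))) ∂P =
          ENNReal.ofReal (Real.Gamma (α + #{i | f i = j}) / Real.Gamma α *
            (1 + u) ^ (-(α + #{i | f i = j}))) := by
      intro j _
      rw [← lintegral_pow_mul_exp_gammaMeasure hα hu0.le, ← hlaw j,
        lintegral_map (hφ j) (hS j)]
    rw [Finset.prod_congr rfl h6, ← ENNReal.ofReal_prod_of_nonneg, Finset.prod_mul_distrib,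
      ← Real.rpow_sum_of_pos (by positivity), Finset.sum_neg_distrib, Finset.sum_add_distrib,
      ← Nat.cast_sum, sum_card_fiber, Finset.sum_const, Finset.card_univ, nsmul_eq_mul]
    · rw [← polyaWeight, ENNReal.ofReal_mul (polyaWeight_pos hα f).le]
      ring
    · intro j _
      have := Real.Gamma_pos_of_pos hα
      have := Real.Gamma_pos_of_pos (show 0 < α + #{i | f i = j} by positivity)
      positivity
  rw [setLIntegral_congr_fun measurableSet_Ioi e2, lintegral_const_mul _ (by fun_prop),
    lintegral_rpow_mul_one_add_rpow (by positivity) hn0,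
    ← ENNReal.ofReal_mul (polyaWeight_pos hα f).le]

/-! ### Pólya weights and generalized factorial coefficients. -/

/-- The sum over the partitions of an `n`-set into `k` blocks of the products of the rising
factorials `(α)^{(nⱼ)}` of the block sizes. -/
def partitionWeight (α : ℝ) (n k : ℕ) : ℝ := (-1) ^ n * genFactCoeff (-α) n k

theorem partitionWeight_succ_succ (α : ℝ) (n k : ℕ) :
    partitionWeight α (n + 1) (k + 1) =
      ((k + 1) * α + n) * partitionWeight α n (k + 1) + α * partitionWeight α n k := by
  simp only [partitionWeight, genFactCoeff]
  ring

/-- The urn step: only the fibre over `a` grows, and `Γ(x + 1) = x Γ(x)`. -/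
theorem polyaWeight_cons {n : ℕ} {ι : Type*} [Fintype ι] [DecidableEq ι] {α : ℝ} (hα : 0 < α)
    (a : ι) (f : Fin n → ι) :
    polyaWeight α (Fin.cons a f : Fin (n + 1) → ι) =
      (α + #{i | f i = a}) * polyaWeight α f := by
  have hc : ∀ j, #{i | (Fin.cons a f : Fin (n + 1) → ι) i = j} =
      (if a = j then 1 else 0) + #{i | f i = j} := by
    intro j
    simp only [Finset.card_filter, Fin.sum_univ_succ, Fin.cons_zero, Fin.cons_succ]
  have hj : ∀ j ∈ (univ : Finset ι),
      Real.Gamma (α + #{i | (Fin.cons a f : Fin (n + 1) → ι) i = j}) / Real.Gamma α =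
        (if a = j then α + #{i | f i = j} else 1) *
          (Real.Gamma (α + #{i | f i = j}) / Real.Gamma α) := by
    intro j _
    rw [hc]
    split_ifs with h
    · rw [Nat.cast_add, Nat.cast_one, add_comm (1 : ℝ), ← add_assoc,
        Real.Gamma_add_one (by positivity)]
      ring
    · simp
  rw [polyaWeight, Finset.prod_congr rfl hj, Finset.prod_mul_distrib, Finset.prod_ite_eq,
    if_pos (mem_univ _), polyaWeight]

theorem polyaWeight_perm_comp {n : ℕ} {ι : Type*} [Fintype ι] [DecidableEq ι] (α : ℝ)
    (σ : Equiv.Perm ι) (f : Fin n → ι) : polyaWeight α (σ ∘ f) = polyaWeight α f := by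
  unfold polyaWeight
  rw [← Equiv.prod_comp σ]
  simp

/-- Either `a` is an old value, and the factors `α + n_a` over the `k + 1` old values sum to `(k +
1)α + n`; or `a` is one of the `card ι - k` new values, each with factor `α`. -/
theorem sum_polyaWeight_cons {n : ℕ} {ι : Type*} [Fintype ι] [DecidableEq ι] {α : ℝ}
    (hα : 0 < α) (f : Fin n → ι) (k : ℕ) :
    (∑ a, if #(univ.image (Fin.cons a f : Fin (n + 1) → ι)) = k + 1
        then polyaWeight α (Fin.cons a f : Fin (n + 1) → ι) else 0) =
      (if #(univ.image f) = k + 1 then ((k + 1) * α + n) * polyaWeight α f else 0) +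
        (if #(univ.image f) = k then ((Fintype.card ι : ℝ) - k) * α * polyaWeight α f else 0) := by
  have him : ∀ a, univ.image (Fin.cons a f : Fin (n + 1) → ι) = insert a (univ.image f) := by
    intro a
    ext b
    simp [Fin.exists_fin_succ, eq_comm]
  simp only [him, polyaWeight_cons hα]
  set J := univ.image f with hJ
  have hout : ∀ a ∈ Jᶜ, #{i | f i = a} = 0 := by
    intro a ha
    rw [Finset.card_eq_zero, Finset.filter_eq_empty_iff]
    intro i _ h
    exact (Finset.mem_compl.1 ha) (h ▸ mem_image_of_mem f (mem_univ i))
  have hin : ∑ a ∈ J, #{i | f i = a} = n := by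
    have h := Finset.sum_add_sum_compl J fun a => #{i | f i = a}
    rwa [Finset.sum_congr rfl hout, Finset.sum_const_zero, add_zero, sum_card_fiber] at h
  rw [← Finset.sum_add_sum_compl J]
  congr 1
  · rw [Finset.sum_congr rfl (g := fun a => if #J = k + 1
      then (α + #{i | f i = a}) * polyaWeight α f else 0)]
    · split_ifs with h
      · rw [← Finset.sum_mul, Finset.sum_add_distrib, Finset.sum_const, ← Nat.cast_sum, hin, h]
        simp
      · simp
    · intro a ha
      rw [Finset.insert_eq_of_mem ha]
  · rw [Finset.sum_congr rfl (g := fun a => if #J = k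
      then α * polyaWeight α f else 0)]
    · split_ifs with h
      · rw [Finset.sum_const, Finset.card_compl, h, nsmul_eq_mul,
          Nat.cast_sub (h ▸ Finset.card_le_univ J)]
        ring
      · simp
    · intro a ha
      rw [Finset.card_insert_of_notMem (Finset.mem_compl.1 ha), hout a ha]
      simp

theorem sum_polyaWeight_card_image {ι : Type*} [Fintype ι] [DecidableEq ι] {α : ℝ}
    (hα : 0 < α) (n k : ℕ) :
    (∑ f : Fin n → ι, if #(univ.image f) = k then polyaWeight α f else 0) =
      (Fintype.card ι).descFactorial k * partitionWeight α n k := by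
  induction n generalizing k with
  | zero =>
    have hG := (Real.Gamma_pos_of_pos hα).ne'
    cases k <;> simp [partitionWeight, genFactCoeff, polyaWeight, hG]
  | succ n ih =>
    rw [← Equiv.sum_comp (Fin.consEquiv fun _ => ι), Fintype.sum_prod_type, Finset.sum_comm]
    cases k with
    | zero =>
      simp [partitionWeight, genFactCoeff, (univ_nonempty (α := Fin (n + 1))).ne_empty]
    | succ k =>
      have h1 : ∀ f ∈ (univ : Finset (Fin n → ι)), ∑ a,
          (if #(univ.image ((Fin.consEquiv fun _ => ι) (a, f))) = k + 1
            then polyaWeight α ((Fin.consEquiv fun _ => ι) (a, f)) else 0) =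
          ((k + 1) * α + n) * (if #(univ.image f) = k + 1 then polyaWeight α f else 0) +
          ((Fintype.card ι : ℝ) - k) * α * (if #(univ.image f) = k then polyaWeight α f else 0) := by
        intro f _
        simp only [mul_ite, mul_zero]
        exact sum_polyaWeight_cons hα f k
      rw [Finset.sum_congr rfl h1, Finset.sum_add_distrib, ← Finset.mul_sum, ← Finset.mul_sum,
        ih, ih, partitionWeight_succ_succ, Nat.descFactorial_succ]
      -- `descFactorial_succ` has a truncated subtraction; when it truncates, both descending
      -- factorials vanish.
      rcases le_or_gt k (Fintype.card ι) with h | h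
      · rw [Nat.cast_mul, Nat.cast_sub h]
        ring
      · simp [Nat.descFactorial_of_lt h]

theorem card_quotient_ker {n : ℕ} {ι : Type*} [DecidableEq ι] (f : Fin n → ι) :
    Nat.card (Quotient (Setoid.ker f)) = #(univ.image f) := by
  rw [Nat.card_congr (Setoid.quotientKerEquivRange f), Nat.card_coe_set_eq,
    ← Set.ncard_coe_finset]
  simp

theorem IsBlockListing.injective_comp {n k : ℕ} {ρ : Setoid (Fin n) → Fin k → Fin n}
    (hρ : IsBlockListing ρ) {ι : Type*} {f : Fin n → ι}
    (hf : Nat.card (Quotient (Setoid.ker f)) = k) :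
    Function.Injective (f ∘ ρ (Setoid.ker f)) := by
  intro a b hab
  exact (hρ _ hf).1 (Quotient.sound hab)

theorem ker_comp_of_injective {α β γ : Type*} {g : β → γ} (hg : Function.Injective g)
    (f : α → β) : Setoid.ker (g ∘ f) = Setoid.ker f := by
  ext a b
  exact hg.eq_iff

/-- The total Pólya weight of the assignments with `k` values, listed in a given order. -/
theorem sum_polyaWeight_listing {n k : ℕ} {ι : Type*} [Fintype ι] [DecidableEq ι] {α : ℝ}
    (hα : 0 < α) {ρ : Setoid (Fin n) → Fin k → Fin n} (hρ : IsBlockListing ρ) (g : Fin k ↪ ι) :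
    (∑ f : Fin n → ι, if #(univ.image f) = k ∧ f ∘ ρ (Setoid.ker f) = g
      then polyaWeight α f else 0) = partitionWeight α n k := by
  set U : (Fin k ↪ ι) → ℝ := fun g => ∑ f : Fin n → ι,
    if #(univ.image f) = k ∧ f ∘ ρ (Setoid.ker f) = g then polyaWeight α f else 0 with hU
  -- Permutations of `ι` preserve the weight and the partition, and act transitively on injections
  -- from `Fin k`.
  have hconst : ∀ g', U g' = U g := by
    intro g'
    have := Equiv.Perm.isMultiplyPretransitive ι k
    obtain ⟨σ, hσ⟩ := MulAction.exists_smul_eq (Equiv.Perm ι) g' g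
    have hσ' : (g : Fin k → ι) = σ ∘ g' := by
      rw [← hσ]
      rfl
    refine Fintype.sum_equiv (Equiv.arrowCongr (Equiv.refl _) σ) _ _ fun f => ?_
    have h1 : (Equiv.arrowCongr (Equiv.refl (Fin n)) σ) f = σ ∘ f := rfl
    rw [h1, polyaWeight_perm_comp, ker_comp_of_injective σ.injective, hσ', Function.comp_assoc,
      ← Finset.image_image, Finset.card_image_of_injective _ σ.injective]
    simp only [σ.injective.comp_left.eq_iff]
  -- Each `f` with `k` values is listed by exactly one injection, so the common value of `U` is the
  -- total divided by the number of injections.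
  have hsum : ∑ g', U g' = (Fintype.card ι).descFactorial k * partitionWeight α n k := by
    rw [← sum_polyaWeight_card_image hα, hU, Finset.sum_comm]
    refine Finset.sum_congr rfl fun f _ => ?_
    by_cases hf : #(univ.image f) = k
    · have hinj := hρ.injective_comp (f := f) (by rw [card_quotient_ker, hf])
      rw [Finset.sum_eq_single (⟨_, hinj⟩ : Fin k ↪ ι)]
      · simp [hf]
      · intro g' _ hg'
        rw [if_neg]
        rintro ⟨-, h⟩
        exact hg' (DFunLike.coe_injective h.symm)
      · simp
    · simp [hf]
  rw [Finset.sum_congr rfl fun g' _ => hconst g', Finset.sum_const, Finset.card_univ,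
    Fintype.card_embedding_eq, Fintype.card_fin, nsmul_eq_mul] at hsum
  refine mul_left_cancel₀ ?_ hsum
  rw [Nat.cast_ne_zero, ← Nat.pos_iff_ne_zero, Nat.descFactorial_pos]
  simpa using Fintype.card_le_of_embedding g

/-! ### Powers of finite atomic measures, and independence of the marks. -/

variable {Ω : Type*} [MeasurableSpace Ω] {P : Measure Ω} {X : Type*} [MeasurableSpace X]
  {H : Measure ℝ}

/-- On rectangles this is the expansion of a product of sums. -/
theorem pi_sum_smul_dirac {n : ℕ} {ι : Type*} [Fintype ι] [DecidableEq ι] {c : ι → ℝ≥0∞}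
    (hc : ∀ j, c j ≠ ∞) (x : ι → X) :
    Measure.pi (fun _ : Fin n => ∑ j, c j • Measure.dirac (x j)) =
      ∑ f : Fin n → ι, (∏ i, c (f i)) • Measure.dirac (x ∘ f) := by
  have hfin : IsFiniteMeasure (∑ j, c j • Measure.dirac (x j)) := by
    refine ⟨?_⟩
    simp only [Measure.finsetSum_apply, Measure.smul_apply, measure_univ, smul_eq_mul, mul_one]
    exact ENNReal.sum_lt_top.2 fun j _ => (hc j).lt_top
  classical
  refine Measure.pi_eq fun s hs => ?_
  simp only [Measure.finsetSum_apply, Measure.smul_apply, smul_eq_mul,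
    Finset.prod_univ_sum, Fintype.piFinset_univ]
  refine Finset.sum_congr rfl fun f _ => ?_
  rw [Measure.dirac_apply' _ (MeasurableSet.univ_pi hs), Finset.prod_mul_distrib]
  congr 1
  rw [Finset.prod_congr rfl fun i _ => Measure.dirac_apply' (x (f i)) (hs i)]
  simp only [Set.indicator_apply, Pi.one_apply, Finset.prod_ite_zero, Finset.prod_const_one]
  simp

theorem pi_sum_smul_dirac_apply {n : ℕ} {ι : Type*} [Fintype ι] [DecidableEq ι] {c : ι → ℝ≥0∞}
    (hc : ∀ j, c j ≠ ∞) (x : ι → X) {A : Set (Fin n → X)} (hA : MeasurableSet A) :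
    Measure.pi (fun _ : Fin n => ∑ j, c j • Measure.dirac (x j)) A =
      ∑ f : Fin n → ι, (∏ i, c (f i)) * A.indicator 1 (x ∘ f) := by
  simp [pi_sum_smul_dirac hc, Measure.finsetSum_apply, Measure.dirac_apply' _ hA]

theorem measurable_of_natIndexed {β : Type*} [MeasurableSpace β] {N : Ω → ℕ} (hN : Measurable N)
    {F : ℕ → Ω → β} (hF : ∀ m, Measurable (F m)) : Measurable fun ω => F (N ω) ω := by
  have : Measurable fun p : ℕ × Ω => F p.1 p.2 := measurable_from_prod_countable_right hF
  exact this.comp (hN.prodMk measurable_id)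

namespace MarkedPointProcess

variable (Ψ : MarkedPointProcess P X H)

theorem Phi_eq (ω : Ω) : Ψ.Phi ω =
    ∑ j : Fin (Ψ.num ω), (1 : ℝ≥0∞) • Measure.dirac (Ψ.pt j ω) := by
  simp [Phi, Finset.sum_range]

theorem measurable_Phi : Measurable Ψ.Phi := by
  refine measurable_of_natIndexed Ψ.measurable_num
    (F := fun m ω => ∑ j ∈ range m, Measure.dirac (Ψ.pt j ω)) fun m => ?_
  refine Measure.measurable_of_measurable_coe _ fun s hs => ?_
  simp only [Measure.finsetSum_apply]
  exact Finset.measurable_sum _ fun j _ =>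
    (Measure.measurable_coe hs).comp (Measure.measurable_dirac.comp (Ψ.measurable_pt j))

theorem Phi_univ (ω : Ω) : Ψ.Phi ω Set.univ = Ψ.num ω := by
  simp [Phi, Measure.finsetSum_apply]

theorem pi_Phi_apply (ω : Ω) {k : ℕ} {B : Set (Fin k → X)} (hB : MeasurableSet B) :
    Measure.pi (fun _ : Fin k => Ψ.Phi ω) B =
      ∑ g : Fin k → Fin (Ψ.num ω), B.indicator 1 (fun i => Ψ.pt (g i) ω) := by
  rw [Phi_eq, pi_sum_smul_dirac_apply (by simp) _ hB]
  simp [Function.comp_def]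

theorem pTilde_eq (ω : Ω) : Ψ.pTilde ω = ∑ j : Fin (Ψ.num ω),
    ((∑ i : Fin (Ψ.num ω), ENNReal.ofReal (Ψ.mark i ω))⁻¹ * ENNReal.ofReal (Ψ.mark j ω)) •
      Measure.dirac (Ψ.pt j ω) := by
  simp [pTilde, mu, Finset.sum_range, Measure.finsetSum_apply, Finset.smul_sum, mul_smul]

/-- The event that `Φ` has `m` points and that the subfamily of points indexed by `g` is
in `B`. -/
def ptEvent {k : ℕ} (B : Set (Fin k → X)) (m : ℕ) (g : Fin k → Fin m) : Set Ω :=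
  {ω | Ψ.num ω = m ∧ (fun i => Ψ.pt (g i) ω) ∈ B}

theorem measurableSet_ptEvent {k : ℕ} {B : Set (Fin k → X)} (hB : MeasurableSet B) (m : ℕ)
    (g : Fin k → Fin m) : MeasurableSet (Ψ.ptEvent B m g) :=
  (Ψ.measurable_num (measurableSet_singleton m)).inter
    ((measurable_pi_lambda _ fun i => Ψ.measurable_pt (g i)) hB)

/-- The event depends only on `num` and `pt`, hence is independent of the marks. -/
theorem lintegral_ptEvent_mul_mark [IsProbabilityMeasure P] {k : ℕ} {B : Set (Fin k → X)}
    (hB : MeasurableSet B) (m : ℕ) (g : Fin k → Fin m) {h : (ℕ → ℝ) → ℝ≥0∞} (hh : Measurable h) :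
    ∫⁻ ω, (Ψ.ptEvent B m g).indicator 1 ω * h (fun j => Ψ.mark j ω) ∂P =
      P (Ψ.ptEvent B m g) * ∫⁻ ω, h (fun j => Ψ.mark j ω) ∂P := by
  have hset : MeasurableSet {p : ℕ × (ℕ → X) | p.1 = m ∧ (fun i => p.2 (g i)) ∈ B} :=
    (measurable_fst (measurableSet_singleton m)).inter
      ((measurable_pi_lambda _ fun i => (measurable_pi_apply _).comp measurable_snd) hB)
  have hφ : Measurable (Set.indicator {p : ℕ × (ℕ → X) | p.1 = m ∧ (fun i => p.2 (g i)) ∈ B}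
      (1 : ℕ × (ℕ → X) → ℝ≥0∞)) := measurable_one.indicator hset
  have hind := Ψ.indepFun_mark.comp hφ hh
  have hmark : Measurable fun ω j => Ψ.mark j ω := measurable_pi_lambda _ Ψ.measurable_mark
  have hE := Ψ.measurableSet_ptEvent hB m g
  rw [← lintegral_indicator_one hE]
  exact lintegral_mul_eq_lintegral_mul_lintegral_of_indepFun''
    (measurable_one.indicator hE).aemeasurable (hh.comp hmark).aemeasurable hind

end MarkedPointProcess

/-! ### The law of the distinct values. -/

theorem numDistinct_eq_of_injective {Z : Type*} {n m : ℕ} {x : Fin m → Z} (hx : Function.Injective x)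
    (f : Fin n → Fin m) : numDistinct (x ∘ f) = #(univ.image f) := by
  rw [numDistinct, tiePartition, ker_comp_of_injective hx, card_quotient_ker]

theorem measurableSet_distinctValues [MeasurableEq X] {n k : ℕ}
    (ρ : Setoid (Fin n) → Fin k → Fin n) {B : Set (Fin k → X)} (hB : MeasurableSet B) :
    MeasurableSet {y : Fin n → X | numDistinct y = k ∧ distinctValues ρ y ∈ B} := by
  have hcount : Countable (Setoid (Fin n)) :=
    Function.Injective.countable (f := fun s : Setoid (Fin n) => fun a b => s a b)
      fun s t h => Setoid.ext fun a b => iff_of_eq (congrFun (congrFun h a) b)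
  -- Splitting by the tie partition leaves countably many pieces, on each of which the listing `ρ π`
  -- is fixed.
  have hset : {y : Fin n → X | numDistinct y = k ∧ distinctValues ρ y ∈ B} =
      ⋃ π : Setoid (Fin n), {y | (∀ a b, y a = y b ↔ π a b) ∧
        (Nat.card (Quotient π) = k ∧ (fun j => y (ρ π j)) ∈ B)} := by
    ext y
    simp only [Set.mem_ofPred_eq, Set.mem_iUnion]
    constructor
    · rintro ⟨h1, h2⟩
      exact ⟨Setoid.ker y, fun a b => Iff.rfl, h1, h2⟩
    · rintro ⟨π, h1, h2, h3⟩
      obtain rfl : Setoid.ker y = π := Setoid.ext h1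
      exact ⟨h2, h3⟩
  rw [hset]
  refine MeasurableSet.iUnion fun π => MeasurableSet.inter ?_ (MeasurableSet.inter ?_ ?_)
  · change MeasurableSet {y : Fin n → X | ∀ a b, y a = y b ↔ π a b}
    simp only [Set.ofPred_forall]
    refine MeasurableSet.iInter fun a => MeasurableSet.iInter fun b => ?_
    have hab : MeasurableSet {y : Fin n → X | y a = y b} :=
      measurableSet_eq_fun (measurable_pi_apply a) (measurable_pi_apply b)
    by_cases h : π a b
    · simp only [h, iff_true]
      exact hab
    · simp only [h, iff_false]
      exact hab.compl
  · exact MeasurableSet.const _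
  · exact (measurable_pi_lambda _ fun j => measurable_pi_apply (ρ π j)) hB

theorem measurableSet_injective [MeasurableEq X] (k : ℕ) :
    MeasurableSet {x : Fin k → X | Function.Injective x} := by
  simp only [Function.Injective, Set.ofPred_forall]
  refine MeasurableSet.iInter fun a => MeasurableSet.iInter fun b => ?_
  by_cases h : a = b
  · simp [h]
  · simp only [h, imp_false]
    exact (measurableSet_eq_fun (measurable_pi_apply a) (measurable_pi_apply b)).compl

/-- The product of the normalized values `s_{f i} / ∑_{j < m} s_j`. -/
def normalizedProd {n : ℕ} (m : ℕ) (f : Fin n → Fin m) (s : ℕ → ℝ) : ℝ≥0∞ :=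
  ∏ i, ((∑ j : Fin m, ENNReal.ofReal (s j))⁻¹ * ENNReal.ofReal (s (f i)))

theorem measurable_normalizedProd {n : ℕ} (m : ℕ) (f : Fin n → Fin m) :
    Measurable (normalizedProd m f) := by
  unfold normalizedProd
  fun_prop

/-- Only the term `m = num ω` is nonzero; the sum over `m` replaces the random index type `Fin (num
ω)` by deterministic ones. -/
theorem pi_pTilde_ae_eq [MeasurableEq X] {α : ℝ}
    (Ψ : MarkedPointProcess P X (gammaMeasure α 1)) {n k : ℕ}
    (ρ : Setoid (Fin n) → Fin k → Fin n) {B : Set (Fin k → X)} (hB : MeasurableSet B) :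
    ∀ᵐ ω ∂P, Measure.pi (fun _ : Fin n => Ψ.pTilde ω)
        {y : Fin n → X | numDistinct y = k ∧ distinctValues ρ y ∈ B} =
      ∑' m : ℕ, ∑ f : Fin n → Fin m, if #(univ.image f) = k then
        (Ψ.ptEvent B m (f ∘ ρ (Setoid.ker f))).indicator 1 ω *
          normalizedProd m f (fun j => Ψ.mark j ω) else 0 := by
  classical
  set A := {y : Fin n → X | numDistinct y = k ∧ distinctValues ρ y ∈ B} with hA
  have hAm : MeasurableSet A := measurableSet_distinctValues ρ hB
  filter_upwards [Ψ.simple,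
    ae_forall_pos_of_map_gammaMeasure Ψ.measurable_mark Ψ.law_mark] with ω hω hS
  rw [tsum_eq_single (Ψ.num ω)]
  · have hinj : Function.Injective fun j : Fin (Ψ.num ω) => Ψ.pt j ω :=
      fun a b hab => Fin.ext (hω a.2 b.2 hab)
    rw [Ψ.pTilde_eq, pi_sum_smul_dirac_apply _ (fun j : Fin (Ψ.num ω) => Ψ.pt j ω) hAm]
    · refine Finset.sum_congr rfl fun f _ => ?_
      have hmem : (fun j : Fin (Ψ.num ω) => Ψ.pt j ω) ∘ f ∈ A ↔ #(univ.image f) = k ∧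
          ω ∈ Ψ.ptEvent B (Ψ.num ω) (f ∘ ρ (Setoid.ker f)) := by
        have hd : distinctValues ρ ((fun j : Fin (Ψ.num ω) => Ψ.pt j ω) ∘ f) =
            fun i => Ψ.pt ((f ∘ ρ (Setoid.ker f)) i) ω := by
          funext i
          change Ψ.pt (f (ρ (Setoid.ker
            ((fun j : Fin (Ψ.num ω) => Ψ.pt j ω) ∘ f)) i)) ω = _
          rw [ker_comp_of_injective hinj]
          rfl
        simp only [hA, Set.mem_ofPred_eq, numDistinct_eq_of_injective hinj, hd,
          MarkedPointProcess.ptEvent, true_and]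
      simp only [Set.indicator_apply, hmem, Pi.one_apply, ite_and]
      split_ifs <;> simp [normalizedProd]
    · intro j
      refine ENNReal.mul_ne_top (ENNReal.inv_ne_top.2 ?_) ENNReal.ofReal_ne_top
      -- The index `j` itself witnesses positive total mass; for `num ω = 0` there is nothing to
      -- check.
      exact ((ENNReal.ofReal_pos.2 (hS j)).trans_le (Finset.single_le_sum
        (f := fun i : Fin (Ψ.num ω) => ENNReal.ofReal (Ψ.mark i ω)) (fun _ _ => zero_le)
        (mem_univ j))).ne'
  · intro m hm
    refine Finset.sum_eq_zero fun f _ => ?_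
    rw [Set.indicator_of_notMem, zero_mul, ite_self]
    exact fun h => hm h.1.symm

/-- The law of the sample and its distinct values, for gamma jumps. -/
theorem IsSample.measure_distinctValues [IsProbabilityMeasure P] [MeasurableEq X] {α : ℝ}
    (hα : 0 < α) (Ψ : MarkedPointProcess P X (gammaMeasure α 1)) {n k : ℕ} (hn : 1 ≤ n)
    {Y : Ω → Fin n → X} (hY : IsSample Ψ Y) {ρ : Setoid (Fin n) → Fin k → Fin n}
    (hρ : IsBlockListing ρ) {B : Set (Fin k → X)} (hB : MeasurableSet B) :
    P {ω | Ψ.mu ω Set.univ ≠ 0 ∧ numDistinct (Y ω) = k ∧ distinctValues ρ (Y ω) ∈ B} =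
      ENNReal.ofReal (partitionWeight α n k) * ∑' m : ℕ,
        ENNReal.ofReal (Real.Gamma (m * α) / Real.Gamma (m * α + n)) *
          ∑ g : Fin k ↪ Fin m, P (Ψ.ptEvent B m g) := by
  classical
  set A := {y : Fin n → X | numDistinct y = k ∧ distinctValues ρ y ∈ B} with hA
  have hAm : MeasurableSet A := measurableSet_distinctValues ρ hB
  have h1 := hY.2 A hAm Set.univ MeasurableSet.univ
  simp only [Set.mem_univ, and_true, Set.ofPred_true, Measure.restrict_univ] at h1
  have h2 := pi_pTilde_ae_eq Ψ ρ hB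
  have h3 : ∀ m (f : Fin n → Fin m), ∫⁻ ω, (Ψ.ptEvent B m (f ∘ ρ (Setoid.ker f))).indicator 1 ω *
        normalizedProd m f (fun j => Ψ.mark j ω) ∂P = P (Ψ.ptEvent B m (f ∘ ρ (Setoid.ker f))) *
        ENNReal.ofReal (polyaWeight α f *
          (Real.Gamma (m * α) / Real.Gamma (m * α + n))) := by
    intro m f
    rw [Ψ.lintegral_ptEvent_mul_mark hB m _ (measurable_normalizedProd m f)]
    congr 1
    have := lintegral_prod_normalized_gamma hα (S := fun j : Fin m => Ψ.mark j)
      (fun j => Ψ.measurable_mark j) (fun j => Ψ.law_mark j)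
      (Ψ.iIndepFun_mark.precomp Fin.val_injective) hn f
    rwa [Fintype.card_fin] at this
  have hmeas : ∀ m (f : Fin n → Fin m), Measurable fun ω => if #(univ.image f) = k then
        (Ψ.ptEvent B m (f ∘ ρ (Setoid.ker f))).indicator (1 : Ω → ℝ≥0∞) ω *
          normalizedProd m f (fun j => Ψ.mark j ω) else 0 := by
    intro m f
    have h5 : Measurable ((Ψ.ptEvent B m (f ∘ ρ (Setoid.ker f))).indicator (1 : Ω → ℝ≥0∞)) :=
      measurable_one.indicator (Ψ.measurableSet_ptEvent hB m _)
    have h6 : Measurable fun ω => normalizedProd m f (fun j => Ψ.mark j ω) :=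
      (measurable_normalizedProd m f).comp (measurable_pi_lambda _ Ψ.measurable_mark)
    by_cases hf : #(univ.image f) = k
    · simp only [hf, if_true]
      exact h5.mul h6
    · simp only [hf, if_false]
      exact measurable_const
  refine Eq.trans (congrArg P ?_) (h1.trans ?_)
  · rfl
  rw [lintegral_congr_ae h2, lintegral_tsum fun m =>
    (Finset.measurable_sum _ fun f _ => hmeas m f).aemeasurable, ← ENNReal.tsum_mul_left]
  refine tsum_congr fun m => ?_
  rw [lintegral_finsetSum _ fun f _ => hmeas m f]
  -- The constant is expanded over assignments separately for each `g`; after exchanging the sums,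
  -- each `f` with `k` values meets only its own `g`.
  have h4 : ∀ g : Fin k ↪ Fin m, ENNReal.ofReal (partitionWeight α n k) =
      ∑ f : Fin n → Fin m, if #(univ.image f) = k ∧ f ∘ ρ (Setoid.ker f) = g
        then ENNReal.ofReal (polyaWeight α f) else 0 := by
    intro g
    rw [← sum_polyaWeight_listing hα hρ g, ENNReal.ofReal_sum_of_nonneg]
    · exact Finset.sum_congr rfl fun f _ => by split_ifs <;> simp
    · intro f _
      split_ifs
      exacts [(polyaWeight_pos hα f).le, le_rfl]
  rw [mul_left_comm, Finset.mul_sum]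
  rw [Finset.sum_congr rfl fun (g : Fin k ↪ Fin m) _ =>
    congrArg (· * P (Ψ.ptEvent B m g)) (h4 g)]
  simp only [Finset.sum_mul]
  rw [Finset.sum_comm, Finset.mul_sum]
  refine Finset.sum_congr rfl fun f _ => ?_
  by_cases hf : #(univ.image f) = k
  · have hinj := hρ.injective_comp (f := f) (by rw [card_quotient_ker, hf])
    simp only [hf, if_true, true_and]
    rw [h3, Finset.sum_eq_single (⟨_, hinj⟩ : Fin k ↪ Fin m)]
    · rw [ENNReal.ofReal_mul (polyaWeight_pos hα f).le]
      simp
      ring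
    · intro g' _ hg'
      rw [if_neg, zero_mul]
      exact fun h => hg' (DFunLike.coe_injective h.symm)
    · simp
  · simp [hf]

/-! ### Palm distributions. -/

theorem MarkedPointProcess.pi_Phi_eq_zero_of_lt_one (Ψ : MarkedPointProcess P X H) {k : ℕ}
    (i : Fin k) {U : Set X} (hU : MeasurableSet U) {ω : Ω} (h : Ψ.Phi ω U < 1) :
    Measure.pi (fun _ : Fin k => Ψ.Phi ω) {x | x i ∈ U} = 0 := by
  classical
  have hB : MeasurableSet {x : Fin k → X | x i ∈ U} := measurable_pi_apply i hU
  rw [Ψ.pi_Phi_apply ω hB]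
  refine Finset.sum_eq_zero fun g _ => Set.indicator_of_notMem (fun hg => ?_) _
  have hg' : Ψ.pt (g i) ω ∈ U := hg
  refine h.not_ge ?_
  rw [Phi, Measure.finsetSum_apply]
  have := Finset.single_le_sum (f := fun j => Measure.dirac (Ψ.pt j ω) U)
    (fun _ _ => zero_le) (Finset.mem_range.2 (g i).2)
  simpa [Measure.dirac_apply_of_mem hg'] using this

/-- The Campbell measure of `{x i ∈ U} × {ν U < 1}` is zero, because a point of `Φ` in `U` gives `U`
mass at least 1. -/
theorem IsPalm.ae_one_le {Ψ : MarkedPointProcess P X H} {k : ℕ}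
    {κ : Kernel (Fin k → X) (Measure X)} (hκ : IsPalm Ψ κ) (i : Fin k) {U : Set X}
    (hU : MeasurableSet U) :
    ∀ᵐ x ∂(Ψ.momentMeasure k), x i ∈ U → ∀ᵐ ν ∂(κ x), 1 ≤ ν U := by
  have hB : MeasurableSet {x : Fin k → X | x i ∈ U} := measurable_pi_apply i hU
  have hL : MeasurableSet {ν : Measure X | ν U < 1} := Measure.measurable_coe hU measurableSet_Iio
  have h := hκ.2 _ hB _ hL
  have hP : MeasurableSet {ω | Ψ.Phi ω ∈ {ν : Measure X | ν U < 1}} := Ψ.measurable_Phi hL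
  rw [setLIntegral_congr_fun hP
    (fun ω hω => Ψ.pi_Phi_eq_zero_of_lt_one i hU hω), lintegral_zero, eq_comm,
    lintegral_eq_zero_iff (κ.measurable_coe hL), Filter.EventuallyEq,
    ae_restrict_iff' hB] at h
  filter_upwards [h] with x hx hxU
  have := hx hxU
  rw [ae_iff]
  simpa using this

theorem IsPalm.ae_finite {Ψ : MarkedPointProcess P X H} {k : ℕ}
    {κ : Kernel (Fin k → X) (Measure X)} (hκ : IsPalm Ψ κ) :
    ∀ᵐ x ∂(Ψ.momentMeasure k), ∀ᵐ ν ∂(κ x), ν Set.univ < ∞ := by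
  have hL : MeasurableSet {ν : Measure X | ν Set.univ = ∞} :=
    Measure.measurable_coe MeasurableSet.univ (measurableSet_singleton _)
  have h := hκ.2 _ MeasurableSet.univ _ hL
  have he : {ω | Ψ.Phi ω ∈ {ν : Measure X | ν Set.univ = ∞}} = ∅ := by
    ext ω
    simp [Ψ.Phi_univ]
  rw [he, Measure.restrict_empty, lintegral_zero_measure, Measure.restrict_univ, eq_comm,
    lintegral_eq_zero_iff (κ.measurable_coe hL)] at h
  filter_upwards [h] with x hx
  rw [ae_iff]
  simpa using hx

/-- Outer regularity reduces an atom at an arbitrary `x` to countably many conditions, so the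
exceptional null sets can be united. -/
theorem one_le_measure_singleton [TopologicalSpace X] [PolishSpace X] [BorelSpace X]
    {ν : Measure X} [IsFiniteMeasure ν] {x : X}
    (h : ∀ U ∈ TopologicalSpace.countableBasis X, x ∈ U → 1 ≤ ν U) : 1 ≤ ν {x} := by
  rw [Set.measure_eq_iInf_isOpen]
  refine le_iInf₂ fun V hV => le_iInf fun hVo => ?_
  obtain ⟨U, hU, hxU, hUV⟩ := (TopologicalSpace.isBasis_countableBasis X).exists_subset_of_mem_open
    (hV rfl) hVo
  exact (h U hU hxU).trans (measure_mono hUV)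

theorem sum_dirac_le [MeasurableSingletonClass X] {ν : Measure X} {k : ℕ} {x : Fin k → X}
    (hx : Function.Injective x) (h : ∀ i, 1 ≤ ν {x i}) : ∑ i, Measure.dirac (x i) ≤ ν := by
  classical
  refine Measure.le_iff.2 fun s hs => ?_
  rw [Measure.finsetSum_apply]
  calc ∑ i, Measure.dirac (x i) s = ∑ i with x i ∈ s, 1 := by
        rw [Finset.sum_filter]
        exact Finset.sum_congr rfl fun i _ => by
          simp [Measure.dirac_apply' _ hs, Set.indicator_apply]
    _ ≤ ∑ i with x i ∈ s, ν {x i} := Finset.sum_le_sum fun i _ => h i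
    _ = ν (⋃ i ∈ ({i | x i ∈ s} : Finset (Fin k)), {x i}) :=
        (measure_biUnion_finset (fun i _ j _ hij => by simpa using hx.ne hij)
          fun i _ => measurableSet_singleton _).symm
    _ ≤ ν s := measure_mono (by simp)

/-- Subtracting measures subtracts total masses once `∑ⱼ δ_{xⱼ} ≤ ν` and the masses are finite. The
Palm identity provides both almost surely; distinctness of the `xⱼ` lets the atoms of `ν` be counted
separately. -/
theorem IsPalm.ae_reducedCount_eq [TopologicalSpace X] [PolishSpace X] [BorelSpace X]
    {Ψ : MarkedPointProcess P X H} {k : ℕ} {κ : Kernel (Fin k → X) (Measure X)}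
    (hκ : IsPalm Ψ κ) :
    ∀ᵐ x ∂(Ψ.momentMeasure k), Function.Injective x → ∀ r : ℕ,
      reducedCount κ x r = κ x {ν | ν Set.univ = ((k + r : ℕ) : ℝ≥0∞)} := by
  have hbasis : ∀ᵐ x ∂(Ψ.momentMeasure k), ∀ U ∈ TopologicalSpace.countableBasis X,
      ∀ i, x i ∈ U → ∀ᵐ ν ∂(κ x), 1 ≤ ν U := by
    refine (ae_ball_iff (TopologicalSpace.countable_countableBasis X)).2 fun U hU => ?_
    exact ae_all_iff.2 fun i => hκ.ae_one_le i
      (TopologicalSpace.isOpen_of_mem_countableBasis hU).measurableSet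
  filter_upwards [hbasis, hκ.ae_finite] with x hx hfin hinj r
  have hx' : ∀ᵐ ν ∂(κ x), ∀ U ∈ TopologicalSpace.countableBasis X, ∀ i, x i ∈ U → 1 ≤ ν U := by
    refine (ae_ball_iff (TopologicalSpace.countable_countableBasis X)).2 fun U hU => ?_
    refine ae_all_iff.2 fun i => ?_
    by_cases hi : x i ∈ U
    · filter_upwards [hx U hU i hi] with ν hν _ using hν
    · exact ae_of_all _ fun _ h => absurd h hi
  refine measure_congr ?_
  filter_upwards [hx', hfin] with ν hν hνfin
  have : IsFiniteMeasure ν := ⟨hνfin⟩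
  have hle : ∑ i, Measure.dirac (x i) ≤ ν :=
    sum_dirac_le hinj fun i => one_le_measure_singleton fun U hU hi => hν U hU i hi
  have hk : (∑ i, Measure.dirac (x i)) Set.univ = (k : ℝ≥0∞) := by
    simp [Measure.finsetSum_apply]
  have hkle : (k : ℝ≥0∞) ≤ ν Set.univ := hk ▸ hle Set.univ
  have hfs : IsFiniteMeasure (∑ i, Measure.dirac (x i)) := ⟨by simp [hk]⟩
  refine propext ?_
  change (ν - ∑ i, Measure.dirac (x i)) Set.univ = (r : ℝ≥0∞) ↔
    ν Set.univ = ((k + r : ℕ) : ℝ≥0∞)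
  rw [Measure.sub_apply MeasurableSet.univ hle, hk, Nat.cast_add]
  constructor
  · intro h
    rw [← h, add_tsub_cancel_of_le hkle]
  · intro h
    rw [h, ENNReal.add_sub_cancel_left (by simp)]

theorem IsPalm.setLIntegral_card_eq [MeasurableEq X] {Ψ : MarkedPointProcess P X H} {k : ℕ}
    {κ : Kernel (Fin k → X) (Measure X)} (hκ : IsPalm Ψ κ) {B : Set (Fin k → X)}
    (hB : MeasurableSet B) (m : ℕ) :
    ∫⁻ x in B ∩ {x | Function.Injective x}, κ x {ν | ν Set.univ = (m : ℝ≥0∞)}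
        ∂(Ψ.momentMeasure k) = ∑ g : Fin k ↪ Fin m, P (Ψ.ptEvent B m g) := by
  classical
  have hBi : MeasurableSet (B ∩ {x | Function.Injective x}) := hB.inter (measurableSet_injective k)
  have hL : MeasurableSet {ν : Measure X | ν Set.univ = (m : ℝ≥0∞)} :=
    Measure.measurable_coe MeasurableSet.univ (measurableSet_singleton _)
  have hP : MeasurableSet {ω | Ψ.Phi ω ∈ {ν : Measure X | ν Set.univ = (m : ℝ≥0∞)}} :=
    Ψ.measurable_Phi hL
  rw [← hκ.2 _ hBi _ hL, ← lintegral_indicator hP]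
  have h : ∀ᵐ ω ∂P, {ω | Ψ.Phi ω ∈ {ν : Measure X | ν Set.univ = (m : ℝ≥0∞)}}.indicator
      (fun ω => Measure.pi (fun _ : Fin k => Ψ.Phi ω) (B ∩ {x | Function.Injective x})) ω =
      ∑ g : Fin k ↪ Fin m, (Ψ.ptEvent B m g).indicator 1 ω := by
    filter_upwards [Ψ.simple] with ω hω
    by_cases hm : Ψ.num ω = m
    · subst hm
      have hinj : Function.Injective fun j : Fin (Ψ.num ω) => Ψ.pt j ω :=
        fun a b hab => Fin.ext (hω a.2 b.2 hab)
      rw [Set.indicator_of_mem (by simp [Ψ.Phi_univ]), Ψ.pi_Phi_apply ω hBi]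
      -- By simplicity, restricting to tuples with distinct entries keeps exactly the injective
      -- index maps.
      have hmem : ∀ g : Fin k → Fin (Ψ.num ω),
          (fun i => Ψ.pt (g i) ω) ∈ {x : Fin k → X | Function.Injective x} ↔
            Function.Injective g := fun g => hinj.of_comp_iff g
      have hz : ∀ g : Fin k → Fin (Ψ.num ω), ¬ Function.Injective g →
          (B ∩ {x | Function.Injective x}).indicator (1 : (Fin k → X) → ℝ≥0∞)
            (fun i => Ψ.pt (g i) ω) = 0 := fun g hg =>
        Set.indicator_of_notMem (fun h => hg ((hmem g).1 h.2)) _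
      rw [← Finset.sum_filter_of_ne (p := Function.Injective)
        fun g _ hg => by_contra fun h => hg (hz g h)]
      rw [← Finset.sum_subtype_of_mem (p := Function.Injective) _ (by simp)]
      refine Finset.sum_bij' (fun g _ => ⟨g.1, g.2⟩) (fun g _ => ⟨g, g.injective⟩) ?_ ?_ ?_ ?_ ?_
      · simp
      · intro g _
        simp [g.injective]
      · simp
      · simp
      · rintro ⟨g, hg⟩ _
        have : (fun i => Ψ.pt (g i) ω) ∈ B ∩ {x : Fin k → X | Function.Injective x} ↔
            ω ∈ Ψ.ptEvent B (Ψ.num ω) g :=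
          ⟨fun h => ⟨rfl, h.1⟩, fun h => ⟨h.2, (hmem g).2 hg⟩⟩
        simp only [Set.indicator_apply, this, Pi.one_apply, Function.Embedding.coeFn_mk]
    · rw [Set.indicator_of_notMem (by simpa [Ψ.Phi_univ] using hm), Finset.sum_eq_zero]
      intro g _
      exact Set.indicator_of_notMem (fun h => hm h.1) _
  rw [lintegral_congr_ae h, lintegral_finsetSum _ fun (g : Fin k ↪ Fin m) _ =>
    measurable_one.indicator (Ψ.measurableSet_ptEvent hB m g)]
  exact Finset.sum_congr rfl fun g _ => lintegral_indicator_one (Ψ.measurableSet_ptEvent hB m g)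

theorem IsPalm.lintegral_reducedCount [TopologicalSpace X] [PolishSpace X] [BorelSpace X]
    {Ψ : MarkedPointProcess P X H} {k : ℕ} {κ : Kernel (Fin k → X) (Measure X)}
    (hκ : IsPalm Ψ κ) {B : Set (Fin k → X)} (hB : MeasurableSet B) (v : ℝ≥0∞) (c : ℕ → ℝ≥0∞) :
    ∫⁻ x in B ∩ {x | Function.Injective x}, v * ∑' r : ℕ, reducedCount κ x r * c (k + r)
        ∂(Ψ.momentMeasure k) =
      v * ∑' m : ℕ, c m * ∑ g : Fin k ↪ Fin m, P (Ψ.ptEvent B m g) := by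
  have hBi : MeasurableSet (B ∩ {x | Function.Injective x}) := hB.inter (measurableSet_injective k)
  have hL : ∀ m : ℕ, MeasurableSet {ν : Measure X | ν Set.univ = (m : ℝ≥0∞)} := fun m =>
    Measure.measurable_coe MeasurableSet.univ (measurableSet_singleton _)
  have hae : ∀ᵐ x ∂(Ψ.momentMeasure k).restrict (B ∩ {x | Function.Injective x}),
      v * ∑' r : ℕ, reducedCount κ x r * c (k + r) =
      v * ∑' r : ℕ, c (k + r) * κ x {ν | ν Set.univ = ((k + r : ℕ) : ℝ≥0∞)} := by
    rw [ae_restrict_iff' hBi]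
    filter_upwards [hκ.ae_reducedCount_eq] with x hx hxB
    congr 1
    exact tsum_congr fun r => by rw [hx hxB.2 r, mul_comm]
  have hms : ∀ r : ℕ, Measurable fun x =>
      c (k + r) * κ x {ν | ν Set.univ = ((k + r : ℕ) : ℝ≥0∞)} := fun r =>
    (κ.measurable_coe (hL _)).const_mul _
  rw [lintegral_congr_ae hae, lintegral_const_mul _ (Measurable.tsum hms),
    lintegral_tsum fun r => (hms r).aemeasurable]
  congr 1
  -- Reindexing by `m = k + r` loses nothing: for `m < k` there are no embeddings.
  rw [← (add_right_injective k).tsum_eq (f := fun m : ℕ =>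
    c m * ∑ g : Fin k ↪ Fin m, P (Ψ.ptEvent B m g))]
  · refine tsum_congr fun r => ?_
    rw [lintegral_const_mul _ (κ.measurable_coe (hL _)), hκ.setLIntegral_card_eq hB]
  · intro m hm
    by_contra hmk
    refine hm ?_
    have : IsEmpty (Fin k ↪ Fin m) := ⟨fun g => hmk ⟨m - k, by
      have := Fintype.card_le_of_embedding g
      simp only [Fintype.card_fin] at this
      simp only
      omega⟩⟩
    simp

end

end NRM

theorem mainTheorem6
    {Ω : Type*} [MeasurableSpace Ω] (P : Measure Ω) [IsProbabilityMeasure P]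
    {X : Type*} [TopologicalSpace X] [PolishSpace X] [MeasurableSpace X] [BorelSpace X]
    (α : ℝ) (hα : 0 < α)
    (Ψ : NRM.MarkedPointProcess P X (gammaMeasure α 1))
    (n k : ℕ) (hn : 1 ≤ n) (hk : 1 ≤ k)
    (Y : Ω → Fin n → X) (hY : NRM.IsSample Ψ Y)
    (κ : Kernel (Fin k → X) (Measure X)) (hκ : NRM.IsPalm Ψ κ)
    (ρ : Setoid (Fin n) → Fin k → Fin n) (hρ : NRM.IsBlockListing ρ)
    (B : Set (Fin k → X)) (hB : MeasurableSet B) :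
    P {ω | Ψ.mu ω Set.univ ≠ 0 ∧ NRM.numDistinct (Y ω) = k ∧
        NRM.distinctValues ρ (Y ω) ∈ B} =
      ∫⁻ x in B ∩ {x | Function.Injective x},
        ENNReal.ofReal ((-1) ^ n * NRM.genFactCoeff (-α) n k) *
          ∑' r : ℕ, NRM.reducedCount κ x r *
            ENNReal.ofReal (Real.Gamma (((k : ℝ) + r) * α) /
              Real.Gamma (((k : ℝ) + r) * α + n))
        ∂(Ψ.momentMeasure k) := by
  -- Here `c m = Γ(mα) / Γ(mα + n)`, evaluated at `m = k + r`.
  rw [hY.measure_distinctValues hα Ψ hn hρ hB, ← hκ.lintegral_reducedCount hB]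
  simp only [NRM.partitionWeight, Nat.cast_add]
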